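/- Let $X$ be a compact metric space with metric $d$ and let $T\colon X\to X$ be continuous. Suppose that $(X,T)$ has the shadowing property: for every $\varepsilon>0$ there is $\delta>0$ such that for every sequence $(x_n)_{n\ge 0}$ in $X$ with $d(T(x_n),x_{n+1})<\delta$ for all $n\ge 0$ there is $y\in X$ with $d(T^n(y),x_n)<\varepsilon$ for all $n\ge 0$. Let $M_T(X)$ be the space of $T$-invariant Borel probability measures on $X$ with the weak* topology. An odometer is a system $(Z,S)$ with $Z$ a compact metric space and $S\colon Z\to Z$ continuous such that the family $\{S^n\colon n\ge 0\}$ is uniformly equicontinuous and some point $z\in Z$ has a dense forward orbit and is regularly recurrent, i.e. for every neighbourhood $U$ of $z$ there is $k\ge 1$ with $S^{kn}(z)\in U$ for all $n\ge 0$ (in particular, periodic orbits are odometers). A measure $\nu\in M_T(X)$ is supported on an odometer if its support $Z=\operatorname{supp}(\nu)$ is such that $(Z,T|_Z)$ is an odometer. Write $x\rightsquigarrow y$ if for every $\delta>0$ there are $n\ge 1$ and points $x=c_0,c_1,\dots,c_n=y$ of $X$ with $d(T(c_i),c_{i+1})<\delta$ for $0\le i<n$, and write $x\sim y$ if $x\rightsquigarrow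 y$ and $y\rightsquigarrow x$. The chain-recurrent classes are the equivalence classes of $\sim$ on the set $\{x\in X\colon x\sim x\}$. (1) If $\mu\in M_T(X)$ and $\operatorname{supp}(\mu)$ is contained in a single chain-recurrent class, then $\mu$ is the weak* limit of a sequence of ergodic measures in $M_T(X)$ that are supported on odometers. (2) If $(X,T)$ is moreover transitive (for any nonempty open sets $U,V\subset X$ there is $n>0$ with $T^n(U)\cap V\ne\emptyset$), then the ergodic measures supported on odometers are dense in $M_T(X)$, and the set of ergodic measures is residual in $M_T(X)$. -/

import Mathlib

open MeasureTheory Filter Topology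

namespace TopDyn

section Metric

variable {X : Type*} [MetricSpace X]

/-- `(X, T)` is (topologically) transitive. -/
def IsTransitive (T : X → X) : Prop :=
  ∀ U V : Set X, IsOpen U → IsOpen V → U.Nonempty → V.Nonempty →
    ∃ n : ℕ, 0 < n ∧ ((T^[n] '' U) ∩ V).Nonempty

/-- `(x n)` is an (infinite) `δ`-pseudo-orbit of `T`. -/
def IsPseudoOrbit (T : X → X) (δ : ℝ) (x : ℕ → X) : Prop :=
  ∀ n : ℕ, dist (T (x n)) (x (n + 1)) < δ

/-- The point `y` `ε`-traces the sequence `(x n)`. -/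
def Traces (T : X → X) (ε : ℝ) (y : X) (x : ℕ → X) : Prop :=
  ∀ n : ℕ, dist (T^[n] y) (x n) < ε

/-- `(X, T)` has the shadowing property. -/
def HasShadowing (T : X → X) : Prop :=
  ∀ ε : ℝ, 0 < ε → ∃ δ : ℝ, 0 < δ ∧
    ∀ x : ℕ → X, IsPseudoOrbit T δ x → ∃ y : X, Traces T ε y x

/-- There is a `δ`-chain `x = c 0, c 1, …, c n = y` of some length `n ≥ 1`. -/
def ExistsChain (T : X → X) (δ : ℝ) (x y : X) : Prop :=
  ∃ n : ℕ, 0 < n ∧ ∃ c : ℕ → X, c 0 = x ∧ c n = y ∧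
    ∀ i < n, dist (T (c i)) (c (i + 1)) < δ

/-- For every `δ > 0` there is a `δ`-chain from `x` to `y`. -/
def ChainsTo (T : X → X) (x y : X) : Prop :=
  ∀ δ : ℝ, 0 < δ → ExistsChain T δ x y

/-- The chain relation `x ∼ y`. -/
def ChainRel (T : X → X) (x y : X) : Prop :=
  ChainsTo T x y ∧ ChainsTo T y x

/-- The set `CR(X, T)` of chain recurrent points. -/
def chainRecurrentSet (T : X → X) : Set X :=
  {x | ChainRel T x x}

/-- The class of `x` under the chain relation; this is a chain-recurrent class when `x` is
chain recurrent. -/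
def chainClass (T : X → X) (x : X) : Set X :=
  {y | ChainRel T x y}

/-- `x` is regularly recurrent: it returns to each of its neighbourhoods at all multiples of some
positive time. -/
def IsRegularlyRecurrent (T : X → X) (x : X) : Prop :=
  ∀ U ∈ 𝓝 x, ∃ k : ℕ, 0 < k ∧ ∀ n : ℕ, T^[k * n] x ∈ U

/-- The system `(X, T)` is an odometer: it is equicontinuous and is the orbit closure of a
regularly recurrent point. (A periodic orbit is an odometer in this sense.) -/
def IsOdometer (T : X → X) : Prop :=
  UniformEquicontinuous (fun n : ℕ => T^[n]) ∧
    ∃ x : X, IsRegularlyRecurrent T x ∧ closure (Set.range fun n : ℕ => T^[n] x) = Set.univ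

/-- The set `A` is closed and `T`-invariant, so that `(A, T|_A)` is a subsystem, and this subsystem
is an odometer. -/
def IsOdometerSubsystem (T : X → X) (A : Set X) : Prop :=
  IsClosed A ∧ ∃ h : Set.MapsTo T A A, IsOdometer (h.restrict T A A)

end Metric

section Measures

variable {X : Type*} [MetricSpace X] [MeasurableSpace X] [BorelSpace X]

/-- The space `M_T(X)` of `T`-invariant Borel probability measures, a subset of the space of all
Borel probability measures with the weak* topology. -/
def invariantMeasures (T : X → X) : Set (ProbabilityMeasure X) :=
  {μ | MeasurePreserving T (μ : Measure X) (μ : Measure X)}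

/-- The ergodic measures in `M_T(X)`. -/
def ergodicMeasures (T : X → X) : Set (invariantMeasures T) :=
  {ν | Ergodic T ((ν : ProbabilityMeasure X) : Measure X)}

/-- The ergodic measures in `M_T(X)` that are supported on an odometer, that is, whose support is
a subsystem of `(X, T)` which is an odometer. -/
def odometerMeasures (T : X → X) : Set (invariantMeasures T) :=
  {ν | ν ∈ ergodicMeasures T ∧
    IsOdometerSubsystem T ((ν : ProbabilityMeasure X) : Measure X).support}

end Measures

end TopDyn

/-!
Periodic pseudo-orbits are shadowed by points whose orbit closure is an odometer, and in a
chain-recurrent class there are enough periodic pseudo-orbits to approximate every invariant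
measure.

*Odometers from shadowing* (`exists_isOdometerPoint`). Let `ξ` be a periodic pseudo-orbit of period
`p`, traced by `y`. By compactness two points `T^[p * j] y` are close to each other, so the orbit
segment between them, repeated periodically, is a periodic pseudo-orbit with an error as small as
one likes; as its period is a multiple of `p`, it is close to `ξ` at all times. Iterating this with
summable tracing errors, one obtains periodic sequences that converge uniformly to a true orbit. An
orbit which is a uniform limit of periodic sequences has an odometer as its closure
(`IsOdometerPoint.isOdometerSubsystem`), and the Birkhoff averages of a continuous function come
uniformly close to constants on it. Hence every invariant measure carried by this closure is ergodic
and has it as its support (`IsOdometerPoint.mem_odometerMeasures`), and its integrals are close to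
the averages along `ξ`.

*Approximation* (`exists_periodic_pseudoOrbit_average_near`). Let the support of `μ` lie in one
chain-recurrent class. The integral of `f` with respect to `μ` is that of its Birkhoff average of
order `n`, thus by the law of large numbers close to the mean of `f` over many orbit segments of
length `n` starting in the support. For a given `δ`, the lengths of the `δ`-chains connecting points
of the support are bounded by compactness, so for large `n` the segments can be joined to a periodic
`δ`-pseudo-orbit without affecting the averages.

*The transitive case*. All points are chain-related, so every invariant measure is a limit of the
measures above. Ergodicity is implied by countably many conditions "some Birkhoff average of `f` has
variance less than `η`", with `f` in a dense sequence; each of them is open, and holds on the dense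
set just found (`ergodicMeasures_mem_residual`).
-/

namespace TopDyn

/-! ### Periodic pseudo-orbits and odometers -/

section OdometerPoints

variable {X : Type*} [MetricSpace X] {T : X → X}

/-- The orbit of `y` is a uniform limit of periodic sequences: for every `η > 0` there is `q > 0`
such that the orbit and its shifts by multiples of `q` are `η`-close at all times. This is regular
recurrence made uniform along the orbit; the orbit closure of such a point is an odometer. -/
def IsOdometerPoint (T : X → X) (y : X) : Prop :=
  ∀ η : ℝ, 0 < η → ∃ q : ℕ, 0 < q ∧ ∀ n i : ℕ, dist (T^[q * n + i] y) (T^[i] y) < η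

/-- The closure of the forward orbit of `y`. -/
def orbitClosure (T : X → X) (y : X) : Set X :=
  closure (Set.range fun n : ℕ => T^[n] y)

theorem iterate_mem_orbitClosure (y : X) (n : ℕ) : T^[n] y ∈ orbitClosure T y :=
  subset_closure ⟨n, rfl⟩

theorem isClosed_orbitClosure (y : X) : IsClosed (orbitClosure T y) := isClosed_closure

theorem forall_mem_orbitClosure {y : X} {p : X → Prop} (hp : IsClosed {x | p x})
    (h : ∀ n, p (T^[n] y)) {x : X} (hx : x ∈ orbitClosure T y) : p x :=
  closure_minimal (t := {x | p x}) (by rintro _ ⟨n, rfl⟩; exact h n) hp hx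

theorem mapsTo_orbitClosure (hT : Continuous T) (y : X) :
    Set.MapsTo T (orbitClosure T y) (orbitClosure T y) := fun _ hx =>
  forall_mem_orbitClosure (p := fun x => T x ∈ orbitClosure T y)
    ((isClosed_orbitClosure y).preimage hT)
    (fun n => by
      simpa only [Function.iterate_succ_apply'] using iterate_mem_orbitClosure y (n + 1)) hx

/-- Repeating a finite `δ`-chain `c 0, …, c (p - 1)` that closes up gives a pseudo-orbit. -/
theorem isPseudoOrbit_mod {δ : ℝ} {p : ℕ} (hp : 0 < p) {c : ℕ → X}
    (h : ∀ i, i + 1 < p → dist (T (c i)) (c (i + 1)) < δ)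
    (hlast : ∀ i, i + 1 = p → dist (T (c i)) (c 0) < δ) : IsPseudoOrbit T δ fun n => c (n % p) := by
  intro n
  rcases (Nat.succ_le_of_lt (Nat.mod_lt n hp)).lt_or_eq with h' | h'
  · have : (n + 1) % p = n % p + 1 := by
      rw [Nat.add_mod, Nat.mod_eq_of_lt (a := 1) (by omega), Nat.mod_eq_of_lt h']
    simpa only [this] using h _ h'
  · have : (n + 1) % p = 0 := by
      rw [← Nat.mod_add_div n p, add_right_comm, Nat.add_mul_mod_self_left,
        ← Nat.succ_eq_add_one, h', Nat.mod_self]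
    simpa only [this] using hlast _ h'

/-- The refinement step. If `y` traces a periodic pseudo-orbit `ξ` of period `p`, so does every
`T^[p * j] y`; two of these points are `δ`-close, and the orbit segment between them, repeated
periodically, is a `δ`-pseudo-orbit which stays close to `ξ` at *all* times, because its period is
a multiple of `p`. -/
theorem exists_periodic_pseudoOrbit_of_traces [CompactSpace X] {δ ε : ℝ} {p : ℕ} {ξ : ℕ → X} {y : X}
    (hp : 0 < p) (hξ : Function.Periodic ξ p) (hy : Traces T ε y ξ) (hδ : 0 < δ) :
    ∃ (q : ℕ) (ζ : ℕ → X), 0 < q ∧ Function.Periodic ζ q ∧ IsPseudoOrbit T δ ζ ∧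
      ∀ n, dist (ξ n) (ζ n) < ε := by
  -- two points of the orbit of `y` under `T^[p]` are `δ`-close, by compactness
  obtain ⟨_, -, φ, hφ, hlim⟩ := isCompact_univ.tendsto_subseq
    (x := fun j : ℕ => T^[p * j] y) (fun _ => Set.mem_univ _)
  obtain ⟨M, hM⟩ := Metric.cauchySeq_iff'.1 hlim.cauchySeq δ hδ
  have h1 := hM (M + 1) (Nat.le_succ _)
  obtain ⟨l, hl⟩ : ∃ l, φ (M + 1) = φ M + (l + 1) :=
    ⟨φ (M + 1) - φ M - 1, by have := hφ (Nat.lt_add_one M); omega⟩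
  set z : X := T^[p * φ M] y with hz
  set q : ℕ := p * (l + 1) with hq
  have hqpos : 0 < q := by positivity
  have hqz : dist (T^[q] z) z < δ := by
    rw [hz, ← Function.iterate_add_apply, hq, ← mul_add, add_comm (l + 1), ← hl]
    exact h1
  refine ⟨q, fun n => T^[n % q] z, hqpos, fun n => by simp,
    isPseudoOrbit_mod (c := fun i => T^[i] z) hqpos (fun i _ => ?_) (fun i hi => ?_), fun n => ?_⟩
  · rwa [← Function.iterate_succ_apply' T, dist_self]
  · rw [← Function.iterate_succ_apply' T, Nat.succ_eq_add_one, hi]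
    exact hqz
  · have h2 := hy (n % q + p * φ M)
    have h3 : ξ (n % q + p * φ M) = ξ n := by
      have e1 : ξ (n % q + p * φ M) = ξ (n % q) := by
        rw [mul_comm]; exact (hξ.nat_mul (φ M)) (n % q)
      rw [e1]
      have e2 := (hξ.nat_mul ((l + 1) * (n / q))) (n % q)
      rw [← e2]
      congr 1
      conv_rhs => rw [← Nat.mod_add_div n q]
      simp only [hq, Nat.cast_id]; ring
    rw [h3, Function.iterate_add_apply, dist_comm] at h2
    exact h2

/-- **Shadowing by odometer points**. Iterating the refinement step along a sequence of tracing
errors `ε / 2 ^ (k + 1)` gives periodic pseudo-orbits that converge uniformly in time, and their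
limit is a true orbit since the pseudo-orbit errors tend to `0`. -/
theorem exists_isOdometerPoint [CompactSpace X] (hT : Continuous T) (hs : HasShadowing T)
    {ε : ℝ} (hε : 0 < ε) :
    ∃ δ : ℝ, 0 < δ ∧ ∀ (p : ℕ) (ξ : ℕ → X), 0 < p → Function.Periodic ξ p → IsPseudoOrbit T δ ξ →
      ∃ y, IsOdometerPoint T y ∧ ∀ n, dist (T^[n] y) (ξ n) ≤ ε := by
  have hs' : ∀ k : ℕ, ∃ δ : ℝ, 0 < δ ∧ δ ≤ (1 / 2) ^ k ∧
      ∀ x : ℕ → X, IsPseudoOrbit T δ x → ∃ y : X, Traces T (ε / 2 / 2 ^ k) y x := by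
    intro k
    obtain ⟨δ, h0, h⟩ := hs (ε / 2 / 2 ^ k) (by positivity)
    exact ⟨min δ ((1 / 2) ^ k), lt_min h0 (by positivity), min_le_right _ _,
      fun x hx => h x fun n => (hx n).trans_le (min_le_left _ _)⟩
  choose δ hδ0 hδ hδs using hs'
  refine ⟨δ 0, hδ0 0, fun p₀ ξ₀ hp₀ hξ₀ hξδ₀ => ?_⟩
  -- the stages of the construction: periodic `δ k`-pseudo-orbits together with a period
  let S : ℕ → Type _ := fun k =>
    {s : ℕ × (ℕ → X) // 0 < s.1 ∧ Function.Periodic s.2 s.1 ∧ IsPseudoOrbit T (δ k) s.2}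
  have step : ∀ k (s : S k), ∃ t : S (k + 1), ∀ n, dist (s.1.2 n) (t.1.2 n) < ε / 2 / 2 ^ k := by
    rintro k ⟨⟨p, ξ⟩, hp, hξ, hξδ⟩
    obtain ⟨y, hy⟩ := hδs k ξ hξδ
    obtain ⟨q, ζ, h1, h2, h3, h4⟩ :=
      exists_periodic_pseudoOrbit_of_traces hp hξ hy (hδ0 (k + 1))
    exact ⟨⟨⟨q, ζ⟩, h1, h2, h3⟩, h4⟩
  choose next hnext using step
  let s : ∀ k, S k := fun k => Nat.rec ⟨⟨p₀, ξ₀⟩, hp₀, hξ₀, hξδ₀⟩ next k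
  have hclose : ∀ n k, dist ((s k).1.2 n) ((s (k + 1)).1.2 n) ≤ ε / 2 / 2 ^ k :=
    fun n k => (hnext k (s k) n).le
  have hlim : ∀ n, ∃ a, Tendsto (fun k => (s k).1.2 n) atTop (𝓝 a) := fun n =>
    cauchySeq_tendsto_of_complete (cauchySeq_of_le_geometric_two (hclose n))
  choose u hu using hlim
  have hdist : ∀ k n, dist ((s k).1.2 n) (u n) ≤ ε / 2 ^ k := fun k n =>
    dist_le_of_le_geometric_two_of_tendsto (hclose n) (hu n) k
  have hTu : ∀ n, T (u n) = u (n + 1) := by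
    intro n
    have h1 : Tendsto (fun k => dist (T ((s k).1.2 n)) ((s k).1.2 (n + 1))) atTop
        (𝓝 (dist (T (u n)) (u (n + 1)))) :=
      ((hT.tendsto _).comp (hu n)).dist (hu (n + 1))
    have h2 : Tendsto (fun k => dist (T ((s k).1.2 n)) ((s k).1.2 (n + 1))) atTop (𝓝 0) :=
      squeeze_zero (fun _ => dist_nonneg) (fun k => ((s k).2.2.2 n).le.trans (hδ k))
        (tendsto_pow_atTop_nhds_zero_of_lt_one (by norm_num) (by norm_num))
    exact dist_eq_zero.1 (tendsto_nhds_unique h1 h2)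
  have hiter : ∀ n, T^[n] (u 0) = u n := by
    intro n
    induction n with
    | zero => rfl
    | succ n ih => rw [Function.iterate_succ_apply', ih, hTu]
  refine ⟨u 0, fun η hη => ?_, fun n => ?_⟩
  · have hz : Tendsto (fun k : ℕ => 2 * ε * (1 / 2 : ℝ) ^ k) atTop (𝓝 (2 * ε * 0)) :=
      (tendsto_pow_atTop_nhds_zero_of_lt_one (by norm_num) (by norm_num)).const_mul _
    rw [mul_zero] at hz
    obtain ⟨k, hk⟩ := (hz.eventually_lt_const hη).exists
    refine ⟨(s k).1.1, (s k).2.1, fun n i => ?_⟩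
    have hper : (s k).1.2 ((s k).1.1 * n + i) = (s k).1.2 i := by
      rw [add_comm, mul_comm]; exact ((s k).2.2.1.nat_mul n) i
    rw [hiter, hiter]
    have h1 := hdist k ((s k).1.1 * n + i)
    rw [hper, dist_comm] at h1
    calc dist (u ((s k).1.1 * n + i)) (u i) ≤ ε / 2 ^ k + ε / 2 ^ k :=
          (dist_triangle _ _ _).trans (add_le_add h1 (hdist k i))
      _ = 2 * ε * (1 / 2) ^ k := by rw [one_div, inv_pow]; ring
      _ < η := hk
  · have h := hdist 0 n
    rw [pow_zero, div_one, dist_comm] at h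
    rw [hiter]
    exact h

theorem IsOdometerPoint.isOdometerSubsystem [CompactSpace X] (hT : Continuous T) {y : X}
    (hy : IsOdometerPoint T y) : IsOdometerSubsystem T (orbitClosure T y) := by
  have hmaps := mapsTo_orbitClosure hT y
  have hval : ∀ n (x : orbitClosure T y),
      (((hmaps.restrict T _ _)^[n] x : orbitClosure T y) : X) = T^[n] x := by
    intro n x
    rw [hmaps.iterate_restrict]
    rfl
  refine ⟨isClosed_orbitClosure y, hmaps, ?_, ⟨y, iterate_mem_orbitClosure y 0⟩, ?_, ?_⟩
  · -- up to `η`, only the iterates `T^[r]` with `r < q` occur on the orbit closure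
    rw [Metric.uniformEquicontinuous_iff]
    intro ε hε
    obtain ⟨q, hq, hqy⟩ := hy (ε / 4) (by positivity)
    have hmod : ∀ n, ∀ x ∈ orbitClosure T y, dist (T^[n] x) (T^[n % q] x) ≤ ε / 4 := by
      intro n x hx
      refine forall_mem_orbitClosure (p := fun x => dist (T^[n] x) (T^[n % q] x) ≤ ε / 4)
        (isClosed_le ((hT.iterate _).dist (hT.iterate _)) continuous_const) (fun m => ?_) hx
      have h := hqy (n / q) (n % q + m)
      rw [← add_assoc, Nat.div_add_mod] at h
      rw [← Function.iterate_add_apply, ← Function.iterate_add_apply]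
      exact h.le
    have hfin : ∀ᶠ d in 𝓝[>] (0 : ℝ), ∀ r ∈ Finset.range q, ∀ a b : X, dist a b < d →
        dist (T^[r] a) (T^[r] b) < ε / 4 := by
      rw [Filter.eventually_all_finset]
      intro r _
      obtain ⟨d, hd, h⟩ := Metric.uniformContinuous_iff.1
        (CompactSpace.uniformContinuous_of_continuous (hT.iterate r)) (ε / 4) (by positivity)
      filter_upwards [Ioo_mem_nhdsGT hd] with d' hd' a b hab
      exact h (hab.trans hd'.2)
    obtain ⟨d, hd, hd0⟩ := (hfin.and self_mem_nhdsWithin).exists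
    refine ⟨d, hd0, fun a b hab n => ?_⟩
    rw [Subtype.dist_eq, hval, hval]
    have h1 := hmod n a a.2
    have h2 := hmod n b b.2
    have h3 := hd (n % q) (Finset.mem_range.2 (Nat.mod_lt _ hq)) a b hab
    have h4 := dist_triangle4 (T^[n] (a : X)) (T^[n % q] a) (T^[n % q] b) (T^[n] b)
    rw [dist_comm (T^[n % q] (b : X))] at h4
    linarith
  · intro U hU
    obtain ⟨ε, hε, hU⟩ := Metric.mem_nhds_iff.1 hU
    obtain ⟨q, hq, hqy⟩ := hy ε hε
    refine ⟨q, hq, fun n => hU ?_⟩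
    rw [Metric.mem_ball, Subtype.dist_eq, hval]
    exact hqy n 0
  · rw [Set.eq_univ_iff_forall]
    rintro ⟨x, hx⟩
    rw [closure_subtype]
    rw [← Set.range_comp]
    simp only [Function.comp_def, hval]
    exact hx

end OdometerPoints

/-! ### Invariant measures on the orbit closure of an odometer point -/

section OdometerMeasures

variable {X : Type*} [MetricSpace X] {T : X → X}

theorem sum_range_add_of_periodic {p : ℕ} {g : ℕ → ℝ} (hg : Function.Periodic g p) (m : ℕ) :
    ∑ i ∈ Finset.range p, g (m + i) = ∑ i ∈ Finset.range p, g i := by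
  induction m with
  | zero => simp
  | succ m ih =>
    have h := (Finset.sum_range_succ (fun i => g (m + i)) p).symm.trans
      (Finset.sum_range_succ' (fun i => g (m + i)) p)
    simp only [hg m, add_zero] at h
    rw [← ih]
    simpa only [add_assoc, add_comm 1] using (add_right_cancel h).symm

theorem continuous_birkhoffAverage (hT : Continuous T) {f : X → ℝ} (hf : Continuous f) (n : ℕ) :
    Continuous (birkhoffAverage ℝ T f n) := by
  have h : Continuous fun x => ∑ i ∈ Finset.range n, f (T^[i] x) :=
    continuous_finsetSum _ fun i _ => hf.comp (hT.iterate i)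
  exact h.const_smul (n : ℝ)⁻¹

/-- If `f` takes `κ`-close values along the orbit of `y` and along a sequence `ξ` of period `p`,
then on the whole orbit closure of `y` the `p`-th Birkhoff average of `f` is `κ`-close to the average of
`f` over one period of `ξ`. -/
theorem abs_birkhoffAverage_sub_le (hT : Continuous T) {f : X → ℝ} (hf : Continuous f)
    {p : ℕ} (hp : 0 < p) {ξ : ℕ → X} (hξ : Function.Periodic ξ p) {y : X} {κ : ℝ}
    (h : ∀ n, |f (T^[n] y) - f (ξ n)| ≤ κ) {x : X} (hx : x ∈ orbitClosure T y) :
    |birkhoffAverage ℝ T f p x - (∑ i ∈ Finset.range p, f (ξ i)) / p| ≤ κ := by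
  refine forall_mem_orbitClosure
    (p := fun x => |birkhoffAverage ℝ T f p x - (∑ i ∈ Finset.range p, f (ξ i)) / p| ≤ κ)
    (isClosed_le ((continuous_birkhoffAverage hT hf p).sub continuous_const).abs
      continuous_const) (fun m => ?_) hx
  have hp' : (0 : ℝ) < p := by exact_mod_cast hp
  have hper : Function.Periodic (fun i => f (ξ i)) p := fun i => by simp only [hξ i]
  rw [← sum_range_add_of_periodic hper m, birkhoffAverage, birkhoffSum, smul_eq_mul,
    inv_mul_eq_div, ← sub_div, ← Finset.sum_sub_distrib, abs_div, abs_of_pos hp', div_le_iff₀ hp']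
  refine (Finset.abs_sum_le_sum_abs _ _).trans ?_
  refine (Finset.sum_le_card_nsmul _ _ κ fun i _ => ?_).trans_eq (by simp [mul_comm])
  rw [← Function.iterate_add_apply, add_comm i m]
  exact h (m + i)

variable [MeasurableSpace X] [BorelSpace X]

theorem integrable_of_continuous [CompactSpace X] {ν : Measure X} [IsFiniteMeasure ν] {f : X → ℝ}
    (hf : Continuous f) : Integrable f ν :=
  (BoundedContinuousFunction.mkOfCompact ⟨f, hf⟩).integrable ν

omit [MetricSpace X] [BorelSpace X] in
theorem integrable_comp_iterate {ν : Measure X}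
    (hν : MeasurePreserving T ν ν) {f : X → ℝ} (hf : Integrable f ν) (i : ℕ) :
    Integrable (fun x => f (T^[i] x)) ν :=
  (hν.iterate i).integrable_comp_of_integrable hf

omit [MetricSpace X] [BorelSpace X] in
theorem integrable_birkhoffAverage {ν : Measure X}
    (hν : MeasurePreserving T ν ν) {f : X → ℝ} (hf : Integrable f ν) (n : ℕ) :
    Integrable (birkhoffAverage ℝ T f n) ν := by
  have h : Integrable (fun x => ∑ i ∈ Finset.range n, f (T^[i] x)) ν :=
    integrable_finsetSum _ fun i _ => integrable_comp_iterate hν hf i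
  exact h.smul (n : ℝ)⁻¹

omit [MetricSpace X] [BorelSpace X] in
theorem integral_birkhoffAverage {ν : Measure X} (hν : MeasurePreserving T ν ν)
    {f : X → ℝ} (hf : Integrable f ν) {n : ℕ} (hn : 0 < n) :
    ∫ x, birkhoffAverage ℝ T f n x ∂ν = ∫ x, f x ∂ν := by
  have hn' : (n : ℝ) ≠ 0 := by positivity
  have h : ∀ i, ∫ x, f (T^[i] x) ∂ν = ∫ x, f x ∂ν := fun i => by
    have hi := (hν.iterate i).map_eq
    rw [← integral_map (hν.iterate i).measurable.aemeasurable (by rw [hi]; exact hf.1), hi]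
  simp only [birkhoffAverage, birkhoffSum, smul_eq_mul]
  rw [integral_const_mul, integral_finsetSum _ fun i _ => integrable_comp_iterate hν hf i]
  simp only [h, Finset.sum_const, Finset.card_range, nsmul_eq_mul]
  field_simp

/-- **Krylov–Bogoliubov**: a cluster point of the empirical measures along the orbit of `y` is an
invariant probability measure carried by the orbit closure of `y`. -/
theorem exists_invariant_orbitClosure [CompactSpace X] (hT : Continuous T) (y : X) :
    ∃ ν : invariantMeasures T, ∀ᵐ x ∂((ν : ProbabilityMeasure X) : Measure X),
      x ∈ orbitClosure T y := by
  let m : ℕ → Measure X := fun n =>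
    ((n : ENNReal) + 1)⁻¹ • ∑ i ∈ Finset.range (n + 1), Measure.dirac (T^[i] y)
  have hm : ∀ n, IsProbabilityMeasure (m n) := fun n => ⟨by
    simp only [m, Measure.smul_apply, Measure.coe_finsetSum, Finset.sum_apply, measure_univ,
      Finset.sum_const, Finset.card_range, smul_eq_mul, nsmul_eq_mul, mul_one, Nat.cast_add,
      Nat.cast_one]
    exact ENNReal.inv_mul_cancel (by simp) (by simp)⟩
  have hint : ∀ n (f : X → ℝ), Continuous f →
      ∫ x, f x ∂(m n) = birkhoffAverage ℝ T f (n + 1) y := by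
    intro n f hf
    rw [integral_smul_measure, integral_finsetSum_measure fun i _ => integrable_of_continuous hf]
    simp only [integral_dirac, birkhoffAverage, birkhoffSum]
    congr 1
    rw [ENNReal.toReal_inv]
    norm_cast
  let u : Ultrafilter (ProbabilityMeasure X) :=
    (hyperfilter ℕ).map fun n => (⟨m n, hm n⟩ : ProbabilityMeasure X)
  obtain ⟨ν, -, hν⟩ := isCompact_univ.ultrafilter_le_nhds u (by simp)
  have hlim : ∀ f : X → ℝ, Continuous f → Tendsto (fun n : ℕ => birkhoffAverage ℝ T f (n + 1) y)
      (hyperfilter ℕ : Filter ℕ) (𝓝 (∫ x, f x ∂(ν : Measure X))) := by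
    intro f hf
    have h := (ProbabilityMeasure.tendsto_iff_forall_integral_tendsto
      (F := (hyperfilter ℕ : Filter ℕ))
      (μs := fun n => (⟨m n, hm n⟩ : ProbabilityMeasure X)) (μ := ν)).1 hν
      (BoundedContinuousFunction.mkOfCompact ⟨f, hf⟩)
    refine h.congr fun n => ?_
    exact hint n f hf
  have hinv : MeasurePreserving T (ν : Measure X) (ν : Measure X) := by
    refine ⟨hT.measurable, ?_⟩
    have := Measure.isProbabilityMeasure_map (μ := (ν : Measure X)) hT.aemeasurable
    refine ext_of_forall_integral_eq_of_IsFiniteMeasure fun f => ?_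
    rw [integral_map hT.aemeasurable f.continuous.aestronglyMeasurable]
    have h1 := (hlim _ (f.continuous.comp hT)).sub (hlim _ f.continuous)
    have hbdd : Bornology.IsBounded (Set.range fun n : ℕ => f (T^[n] y)) :=
      f.isBounded_range.subset (by rintro _ ⟨n, rfl⟩; exact ⟨_, rfl⟩)
    have h2 := ((tendsto_birkhoffAverage_apply_sub_birkhoffAverage ℝ (f := T) (g := f) (x := y)
      hbdd).comp (tendsto_add_atTop_nat 1)).mono_left (Nat.hyperfilter_le_atTop)
    refine sub_eq_zero.1 (tendsto_nhds_unique h1 (h2.congr fun n => ?_))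
    simp only [Function.comp_apply, birkhoffAverage, birkhoffSum, ← Function.iterate_succ_apply,
      ← Function.iterate_succ_apply']
  refine ⟨⟨ν, hinv⟩, ?_⟩
  -- the distance to the orbit closure has integral `0`
  have hd : Continuous fun x => Metric.infDist x (orbitClosure T y) :=
    Metric.continuous_infDist_pt _
  have h0 : ∫ x, Metric.infDist x (orbitClosure T y) ∂(ν : Measure X) = 0 := by
    refine tendsto_nhds_unique (hlim _ hd) (tendsto_const_nhds.congr fun n => ?_)
    simp [birkhoffAverage, birkhoffSum,
      Metric.infDist_zero_of_mem (iterate_mem_orbitClosure (T := T) y _)]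
  rw [integral_eq_zero_iff_of_nonneg (fun _ => Metric.infDist_nonneg)
    (integrable_of_continuous hd)] at h0
  filter_upwards [h0] with x hx
  exact ((isClosed_orbitClosure y).mem_iff_infDist_zero ⟨_, iterate_mem_orbitClosure y 0⟩).2 hx

/-- By invariance, the integral of `f` is that of its Birkhoff averages, so it is `κ`-close to `c`
when one of these averages is. -/
theorem abs_integral_sub_le [CompactSpace X] (hT : Continuous T) {ν : Measure X}
    [IsProbabilityMeasure ν] (hν : MeasurePreserving T ν ν) {f : X → ℝ} (hf : Continuous f)
    {Z : Set X} (hZ : ∀ᵐ x ∂ν, x ∈ Z) {n : ℕ} (hn : 0 < n) {c κ : ℝ}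
    (h : ∀ x ∈ Z, |birkhoffAverage ℝ T f n x - c| ≤ κ) : |∫ x, f x ∂ν - c| ≤ κ := by
  have hi := integrable_of_continuous (ν := ν) (continuous_birkhoffAverage hT hf n)
  have hc : ∫ x, f x ∂ν - c = ∫ x, (birkhoffAverage ℝ T f n x - c) ∂ν := by
    rw [integral_sub hi (integrable_const c),
      integral_birkhoffAverage hν (integrable_of_continuous hf) hn]
    simp
  rw [hc, ← Real.norm_eq_abs]
  refine (norm_integral_le_of_norm_le_const (C := κ) ?_).trans_eq (by simp)
  filter_upwards [hZ] with x hx using h x hx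

omit [MeasurableSpace X] [BorelSpace X] in
theorem IsOdometerPoint.exists_birkhoffAverage_near [CompactSpace X] (hT : Continuous T) {y : X}
    (hy : IsOdometerPoint T y) {f : X → ℝ} (hf : Continuous f) {κ : ℝ} (hκ : 0 < κ) :
    ∃ q : ℕ, 0 < q ∧ ∃ c : ℝ, ∀ x ∈ orbitClosure T y, |birkhoffAverage ℝ T f q x - c| ≤ κ := by
  obtain ⟨η, hη, h⟩ := Metric.uniformContinuous_iff.1
    (CompactSpace.uniformContinuous_of_continuous hf) κ hκ
  obtain ⟨q, hq, hqy⟩ := hy η hη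
  refine ⟨q, hq, _, fun x hx => abs_birkhoffAverage_sub_le hT hf hq
    (ξ := fun n => T^[n % q] y) (fun n => by simp) (fun n => ?_) hx⟩
  have h1 := hqy (n / q) (n % q)
  rw [Nat.div_add_mod] at h1
  exact (h h1).le

/-- The orbit closure of an odometer point is the support of every invariant measure it carries:
all its points visit a given ball around an orbit point within a bounded time. -/
theorem IsOdometerPoint.support_eq [CompactSpace X] (hT : Continuous T) {y : X}
    (hy : IsOdometerPoint T y) {ν : Measure X} (hν : MeasurePreserving T ν ν)
    [IsProbabilityMeasure ν] (hZ : ∀ᵐ x ∂ν, x ∈ orbitClosure T y) :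
    ν.support = orbitClosure T y := by
  refine (Measure.support_subset_of_isClosed (isClosed_orbitClosure y) hZ).antisymm ?_
  refine closure_minimal ?_ Measure.isClosed_support
  rintro _ ⟨i, rfl⟩
  rw [Measure.mem_support_iff_forall]
  intro U hU
  obtain ⟨r, hr, hU⟩ := Metric.mem_nhds_iff.1 hU
  obtain ⟨q, hq, hqy⟩ := hy (r / 4) (by positivity)
  set a : X := T^[i] y with ha
  -- every point of the orbit closure visits `closedBall a (r / 2)` before the time `q`
  have hvisit : orbitClosure T y ⊆ ⋃ j ∈ Finset.range q, T^[j] ⁻¹' Metric.closedBall a (r / 2) := by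
    intro x hx
    refine forall_mem_orbitClosure
      (p := fun x => x ∈ ⋃ j ∈ Finset.range q, T^[j] ⁻¹' Metric.closedBall a (r / 2)) ?_ ?_ hx
    · exact isClosed_biUnion_finset fun j _ => Metric.isClosed_closedBall.preimage (hT.iterate j)
    · intro m
      -- `j < q` is chosen with `j + m ≡ i` modulo `q`
      obtain ⟨t, ht⟩ : ∃ t, q * t + ((q * m + i - m) % q + m) = q * m + i :=
        ⟨(q * m + i - m) / q, by
          rw [← add_assoc, Nat.div_add_mod, Nat.sub_add_cancel]
          exact (Nat.le_mul_of_pos_left m hq).trans (Nat.le_add_right _ _)⟩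
      refine Set.mem_biUnion (Finset.mem_coe.2 (Finset.mem_range.2
        (Nat.mod_lt (q * m + i - m) hq))) ?_
      rw [Set.mem_preimage, Metric.mem_closedBall, ← Function.iterate_add_apply]
      have h1 := hqy t ((q * m + i - m) % q + m)
      rw [ht, dist_comm] at h1
      linarith [dist_triangle (T^[(q * m + i - m) % q + m] y) (T^[q * m + i] y) a, hqy m i]
  by_contra h0
  have h0 : ν U = 0 := by simpa using h0
  have h1 : ν (Metric.closedBall a (r / 2)) = 0 :=
    measure_mono_null ((Metric.closedBall_subset_ball (by linarith)).trans hU) h0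
  have h2 : ν (orbitClosure T y) = 0 := by
    refine measure_mono_null hvisit ((measure_biUnion_null_iff (Finset.countable_toSet _)).2 ?_)
    intro j _
    rw [(hν.iterate j).measure_preimage
      Metric.isClosed_closedBall.measurableSet.nullMeasurableSet, h1]
  have h3 : ν (orbitClosure T y) = 1 := by
    rw [← prob_compl_eq_zero_iff (isClosed_orbitClosure y).measurableSet]
    exact hZ
  rw [h2] at h3
  exact zero_ne_one h3

end OdometerMeasures

/-! ### A criterion for ergodicity -/

section Ergodicity

/-- An indicator function that is approximated in `L¹` by constants is almost everywhere
constant. -/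
theorem measure_eq_zero_or_one_of_abs_indicator_sub {X : Type*} [MeasurableSpace X] {ν : Measure X}
    [IsProbabilityMeasure ν] {s : Set X} (hs : MeasurableSet s)
    (h : ∀ η : ℝ, 0 < η → ∃ c : ℝ, ∫ x, |s.indicator 1 x - c| ∂ν ≤ η) : ν s = 0 ∨ ν s = 1 := by
  have hi : Integrable (s.indicator (1 : X → ℝ)) ν := (integrable_const (1 : ℝ)).indicator hs
  -- `∫ |1_s - c| = |1 - c| ν(s) + |c| (1 - ν(s)) ≥ ν(s) (1 - ν(s))`
  have key : ν.real s * (1 - ν.real s) ≤ 0 := by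
    refine le_of_forall_pos_le_add fun η hη => ?_
    obtain ⟨c, hc⟩ := h η hη
    have he : ∀ x, |s.indicator 1 x - c| =
        |1 - c| * s.indicator (1 : X → ℝ) x + |c| * (1 - s.indicator (1 : X → ℝ) x) := by
      intro x
      by_cases hx : x ∈ s <;> simp [hx]
    simp only [he] at hc
    have hi' : Integrable (fun x => 1 - s.indicator (1 : X → ℝ) x) ν := (integrable_const _).sub hi
    rw [integral_add (hi.const_mul _) (hi'.const_mul _), integral_const_mul, integral_const_mul,
      integral_sub (integrable_const _) hi,
      integral_indicator_one hs] at hc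
    simp only [integral_const, probReal_univ, smul_eq_mul, mul_one] at hc
    have h0 : 0 ≤ ν.real s := measureReal_nonneg
    have h1 : ν.real s ≤ 1 := measureReal_le_one
    have h2 : 1 ≤ |1 - c| + |c| := by
      simpa using abs_add_le (1 - c) c
    nlinarith [mul_nonneg h0 (sub_nonneg.2 h1), mul_nonneg (abs_nonneg (1 - c)) (mul_nonneg h0 h0),
      mul_nonneg (abs_nonneg c) (mul_nonneg (sub_nonneg.2 h1) (sub_nonneg.2 h1))]
  have h0 : 0 ≤ ν.real s := measureReal_nonneg
  have h1 : ν.real s ≤ 1 := measureReal_le_one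
  rcases mul_eq_zero.1 (le_antisymm key (mul_nonneg h0 (sub_nonneg.2 h1))) with h | h
  · left; simpa [measureReal_def, ENNReal.toReal_eq_zero_iff] using h
  · right
    rw [measureReal_def] at h
    exact (ENNReal.toReal_eq_one_iff _).1 (by linarith)

variable {X : Type*} [MetricSpace X] [MeasurableSpace X] [BorelSpace X] {T : X → X}

/-- **Criterion for ergodicity**: for a dense set of continuous functions, some Birkhoff averages
are arbitrarily `L¹`-close to constants. The indicator of an invariant set equals its own
Birkhoff averages, so approximating it in `L¹` by such functions makes it constant. -/
theorem ergodic_of_birkhoffAverage_near_const [CompactSpace X] {ν : Measure X}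
    [IsProbabilityMeasure ν] (hν : MeasurePreserving T ν ν) {D : Set C(X, ℝ)} (hD : Dense D)
    (h : ∀ f ∈ D, ∀ η : ℝ, 0 < η → ∃ n : ℕ, 0 < n ∧
      ∃ c : ℝ, ∫ x, |birkhoffAverage ℝ T f n x - c| ∂ν ≤ η) : Ergodic T ν := by
  refine ⟨hν, ⟨fun s hs hTs => ?_⟩⟩
  suffices ν s = 0 ∨ ν s = 1 by
    rw [eventuallyConst_set']
    rcases this with h | h
    · left; exact ae_eq_empty.2 h
    · right; exact ae_eq_univ.2 ((prob_compl_eq_zero_iff hs).2 h)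
  refine measure_eq_zero_or_one_of_abs_indicator_sub hs fun η hη => ?_
  set χ : X → ℝ := s.indicator 1 with hχ
  have hχi : Integrable χ ν := (integrable_const (1 : ℝ)).indicator hs
  have hχT : ∀ i x, χ (T^[i] x) = χ x := by
    intro i x
    have hi : T^[i] ⁻¹' s = s := by
      induction i with
      | zero => rfl
      | succ i ih => rw [Function.iterate_succ, Set.preimage_comp, ih, hTs]
    have : T^[i] x ∈ s ↔ x ∈ s := by rw [← Set.mem_preimage, hi]
    by_cases hx : x ∈ s <;> simp [hχ, this, hx]
  obtain ⟨g, hg, -⟩ := hχi.exists_boundedContinuous_integral_sub_le (ε := η / 3) (by positivity)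
  obtain ⟨f, hfg, hfD⟩ := Metric.dense_iff.1 hD g.toContinuousMap (η / 3) (by positivity)
  obtain ⟨n, hn, c, hc⟩ := h f hfD (η / 3) (by positivity)
  have hfi : Integrable f ν := integrable_of_continuous f.continuous
  have hχf : Integrable (fun x => |χ x - f x|) ν := (hχi.sub hfi).abs
  have hχg : Integrable (fun x => ‖χ x - g x‖) ν := (hχi.sub (g.integrable ν)).norm
  refine ⟨c, ?_⟩
  have h1 : ∫ x, |χ x - f x| ∂ν ≤ η / 3 + η / 3 := by
    calc ∫ x, |χ x - f x| ∂ν ≤ ∫ x, (‖χ x - g x‖ + η / 3) ∂ν := by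
          refine integral_mono (hχi.sub hfi).abs
            (hχg.add (integrable_const _)) fun x => ?_
          have hx : |g x - f x| ≤ η / 3 :=
            (ContinuousMap.dist_apply_le_dist (f := g.toContinuousMap) (g := f) x).trans
              (Metric.mem_ball'.1 hfg).le
          exact (abs_sub_le _ (g x) _).trans (add_le_add_right hx _)
      _ ≤ η / 3 + η / 3 := by
          rw [integral_add hχg (integrable_const _)]
          simpa using hg
  have h2 : ∀ x, |χ x - birkhoffAverage ℝ T f n x| ≤
      birkhoffAverage ℝ T (fun x => |χ x - f x|) n x := by
    intro x
    have hn' : (0 : ℝ) < n := by exact_mod_cast hn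
    have : χ x = (n : ℝ)⁻¹ * ∑ i ∈ Finset.range n, χ (T^[i] x) := by
      simp only [hχT, Finset.sum_const, Finset.card_range, nsmul_eq_mul]
      field_simp
    rw [this]
    simp only [birkhoffAverage, birkhoffSum, smul_eq_mul]
    rw [← mul_sub, ← Finset.sum_sub_distrib, abs_mul, abs_of_pos (inv_pos.2 hn')]
    exact mul_le_mul_of_nonneg_left (Finset.abs_sum_le_sum_abs _ _) (inv_pos.2 hn').le
  have hAi : Integrable (fun x => |birkhoffAverage ℝ T f n x - c|) ν :=
    ((integrable_birkhoffAverage hν hfi n).sub (integrable_const c)).abs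
  calc ∫ x, |χ x - c| ∂ν
      ≤ ∫ x, (birkhoffAverage ℝ T (fun x => |χ x - f x|) n x +
          |birkhoffAverage ℝ T f n x - c|) ∂ν := by
        refine integral_mono (hχi.sub (integrable_const _)).abs
          ((integrable_birkhoffAverage hν hχf n).add
            hAi) fun x => ?_
        exact (abs_sub_le _ (birkhoffAverage ℝ T f n x) _).trans (add_le_add_left (h2 x) _)
    _ = ∫ x, |χ x - f x| ∂ν + ∫ x, |birkhoffAverage ℝ T f n x - c| ∂ν := by
        rw [integral_add (integrable_birkhoffAverage hν hχf n)
          hAi, integral_birkhoffAverage hν hχf hn]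
    _ ≤ η := by linarith

theorem integral_sub_const_sq [CompactSpace X] {ν : Measure X} [IsProbabilityMeasure ν]
    {g : X → ℝ} (hg : Continuous g) (c : ℝ) :
    ∫ x, (g x - c) ^ 2 ∂ν = ∫ x, g x ^ 2 ∂ν - 2 * c * ∫ x, g x ∂ν + c ^ 2 := by
  have h1 : Integrable (fun x => 2 * c * g x) ν := integrable_of_continuous (by fun_prop)
  have h2 : Integrable (fun x => g x ^ 2) ν := integrable_of_continuous (by fun_prop)
  have h3 : Integrable (fun x => g x ^ 2 - 2 * c * g x) ν := h2.sub h1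
  have he : ∀ x, (g x - c) ^ 2 = g x ^ 2 - 2 * c * g x + c ^ 2 := fun x => by ring
  simp only [he]
  rw [integral_add h3 (integrable_const _), integral_sub h2 h1, integral_const_mul]
  simp

theorem integral_abs_sub_integral_le {ν : Measure X} [IsProbabilityMeasure ν] [CompactSpace X]
    {g : X → ℝ} (hg : Continuous g) {η : ℝ} (hη : 0 < η)
    (h : ∫ x, g x ^ 2 ∂ν - (∫ x, g x ∂ν) ^ 2 ≤ η ^ 2) :
    ∫ x, |g x - ∫ x, g x ∂ν| ∂ν ≤ η := by
  set c := ∫ x, g x ∂ν with hc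
  have hi : Integrable (fun x => |g x - c|) ν := integrable_of_continuous (by fun_prop)
  have hi2 : Integrable (fun x => (g x - c) ^ 2) ν := integrable_of_continuous (by fun_prop)
  -- the inequality `2 η t ≤ t ^ 2 + η ^ 2`, integrated
  have h1 : ∫ x, 2 * η * |g x - c| ∂ν ≤ ∫ x, ((g x - c) ^ 2 + η ^ 2) ∂ν := by
    refine integral_mono (hi.const_mul _) (hi2.add (integrable_const _)) fun x => ?_
    simp only
    nlinarith [sq_nonneg (|g x - c| - η), sq_abs (g x - c)]
  rw [integral_const_mul, integral_add hi2 (integrable_const _), integral_sub_const_sq hg,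
    ← hc] at h1
  simp only [integral_const, probReal_univ, smul_eq_mul, one_mul] at h1
  nlinarith

theorem continuous_variance [CompactSpace X] {g : X → ℝ} (hg : Continuous g) :
    Continuous fun ν : ProbabilityMeasure X =>
      ∫ x, g x ^ 2 ∂(ν : Measure X) - (∫ x, g x ∂(ν : Measure X)) ^ 2 := by
  have h : ∀ f : X → ℝ, Continuous f →
      Continuous fun ν : ProbabilityMeasure X => ∫ x, f x ∂(ν : Measure X) := fun f hf =>
    continuous_iff_continuousAt.2 fun ν =>
      (ProbabilityMeasure.tendsto_iff_forall_integral_tendsto.1 tendsto_id)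
        (BoundedContinuousFunction.mkOfCompact ⟨f, hf⟩)
  exact (h _ (hg.pow 2)).sub ((h _ hg).pow 2)

theorem variance_le_of_near_const [CompactSpace X] {ν : Measure X} [IsProbabilityMeasure ν]
    {g : X → ℝ} (hg : Continuous g) {c κ : ℝ} (hκ : ∀ᵐ x ∂ν, |g x - c| ≤ κ) :
    ∫ x, g x ^ 2 ∂ν - (∫ x, g x ∂ν) ^ 2 ≤ κ ^ 2 := by
  have h1 : ∫ x, (g x - c) ^ 2 ∂ν ≤ ∫ _x, κ ^ 2 ∂ν := by
    refine integral_mono_ae (integrable_of_continuous (by fun_prop)) (integrable_const _) ?_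
    filter_upwards [hκ] with x hx
    exact sq_le_sq' (abs_le.1 hx).1 (abs_le.1 hx).2
  rw [integral_sub_const_sq hg] at h1
  simp only [integral_const, probReal_univ, smul_eq_mul, one_mul] at h1
  nlinarith [sq_nonneg (∫ x, g x ∂ν - c)]

theorem IsOdometerPoint.mem_odometerMeasures [CompactSpace X] (hT : Continuous T) {y : X}
    (hy : IsOdometerPoint T y) {ν : invariantMeasures T}
    (hZ : ∀ᵐ x ∂((ν : ProbabilityMeasure X) : Measure X), x ∈ orbitClosure T y) :
    ν ∈ odometerMeasures T := by
  refine ⟨?_, ?_⟩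
  · refine ergodic_of_birkhoffAverage_near_const ν.2 dense_univ fun f _ η hη => ?_
    obtain ⟨q, hq, c, hc⟩ := hy.exists_birkhoffAverage_near hT f.continuous hη
    refine ⟨q, hq, c, (integral_mono_ae (integrable_of_continuous
      ((continuous_birkhoffAverage hT f.continuous q).sub continuous_const).abs)
      (integrable_const η) ?_).trans_eq (by simp)⟩
    filter_upwards [hZ] with x hx using hc x hx
  · rw [hy.support_eq hT ν.2 hZ]
    exact hy.isOdometerSubsystem hT

/-- By the criterion for ergodicity, the ergodic measures contain the intersection over the
functions `f` of a dense sequence and over `k` of the sets of `ν` such that the variance of some Birkhoff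
average of `f` with respect to `ν` is less than `1 / (k + 1) ^ 2`. These sets are open, since the
variance is continuous in `ν`, and contain every invariant measure carried by the orbit closure
of an odometer point. -/
theorem ergodicMeasures_mem_residual [CompactSpace X] (hT : Continuous T)
    (hd : Dense {ν : invariantMeasures T | ∃ y, IsOdometerPoint T y ∧
      ∀ᵐ x ∂((ν : ProbabilityMeasure X) : Measure X), x ∈ orbitClosure T y}) :
    ergodicMeasures T ∈ residual (invariantMeasures T) := by
  let V : C(X, ℝ) → ℕ → invariantMeasures T → ℝ := fun f n ν =>
    ∫ x, birkhoffAverage ℝ T f n x ^ 2 ∂((ν : ProbabilityMeasure X) : Measure X) -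
      (∫ x, birkhoffAverage ℝ T f n x ∂((ν : ProbabilityMeasure X) : Measure X)) ^ 2
  have hV : ∀ f n, Continuous (V f n) := fun f n =>
    (continuous_variance (continuous_birkhoffAverage hT f.continuous n)).comp continuous_subtype_val
  let G : ℕ × ℕ → Set (invariantMeasures T) := fun a =>
    ⋃ n : ℕ, {ν | 0 < n ∧
      V (TopologicalSpace.denseSeq C(X, ℝ) a.1) n ν < ((1 : ℝ) / (a.2 + 1)) ^ 2}
  have hG : ∀ a, G a ∈ residual (invariantMeasures T) := by
    intro a
    refine residual_of_dense_open (isOpen_iUnion fun n => ?_) (hd.mono ?_)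
    · rcases Nat.eq_zero_or_pos n with rfl | hn
      · simp
      · simpa only [hn, true_and] using isOpen_lt (hV _ n) continuous_const
    · rintro ν ⟨y, hy, hZ⟩
      obtain ⟨q, hq, c, hc⟩ := hy.exists_birkhoffAverage_near hT
        (TopologicalSpace.denseSeq C(X, ℝ) a.1).continuous
        (show (0 : ℝ) < 1 / (a.2 + 1) / 2 by positivity)
      refine Set.mem_iUnion.2 ⟨q, hq, (variance_le_of_near_const
        (continuous_birkhoffAverage hT (ContinuousMap.continuous _) q)
        (hZ.mono fun x hx => hc x hx)).trans_lt ?_⟩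
      have h0 : (0 : ℝ) < 1 / (a.2 + 1) := by positivity
      nlinarith
  refine mem_of_superset (countable_iInter_mem.2 hG) fun ν hν => ?_
  refine ergodic_of_birkhoffAverage_near_const ν.2
    (TopologicalSpace.denseRange_denseSeq C(X, ℝ)) ?_
  rintro _ ⟨j, rfl⟩ η hη
  obtain ⟨k, hk⟩ := exists_nat_one_div_lt hη
  obtain ⟨n, hn, hVn⟩ := Set.mem_iUnion.1 (Set.mem_iInter.1 hν (j, k))
  exact ⟨n, hn, _, (integral_abs_sub_integral_le
    (continuous_birkhoffAverage hT (ContinuousMap.continuous _) n) (by positivity)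
    hVn.le).trans hk.le⟩

end Ergodicity

/-! ### Chains and loops -/

section Chains

variable {X : Type*} [MetricSpace X] {T : X → X}

/-- The points `c 0 = x, c 1, …, c n = y` form a `δ`-chain; the values `c i` with `i > n` are
irrelevant, and `n = 0` is allowed. -/
def IsChain (T : X → X) (δ : ℝ) (n : ℕ) (x y : X) (c : ℕ → X) : Prop :=
  c 0 = x ∧ c n = y ∧ ∀ i < n, dist (T (c i)) (c (i + 1)) < δ

theorem IsChain.exists_append {δ : ℝ} {m n : ℕ} {x y z : X} {c d : ℕ → X}
    (hc : IsChain T δ m x y c) (hd : IsChain T δ n y z d) :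
    ∃ e, IsChain T δ (m + n) x z e ∧ ∀ f : X → ℝ, ∑ i ∈ Finset.range (m + n), f (e i) =
      ∑ i ∈ Finset.range m, f (c i) + ∑ i ∈ Finset.range n, f (d i) := by
  let e : ℕ → X := fun i => if i < m then c i else d (i - m)
  have h1 : ∀ i ≤ m, e i = c i := by
    intro i hi
    rcases hi.lt_or_eq with h | rfl
    · simp [e, h]
    · simp [e, hd.1, hc.2.1]
  have h2 : ∀ i, e (m + i) = d i := fun i => by simp [e]
  refine ⟨e, ⟨(h1 0 (Nat.zero_le _)).trans hc.1, (h2 n).trans hd.2.1, fun i hi => ?_⟩, fun f => ?_⟩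
  · rcases lt_or_ge i m with h | h
    · rw [h1 i h.le, h1 (i + 1) h]
      exact hc.2.2 i h
    · obtain ⟨j, rfl⟩ := Nat.exists_eq_add_of_le h
      rw [add_assoc, h2, h2]
      exact hd.2.2 j (by omega)
  · rw [Finset.sum_range_add]
    congr 1
    · exact Finset.sum_congr rfl fun i hi => by rw [h1 i (Finset.mem_range.1 hi).le]
    · exact Finset.sum_congr rfl fun i _ => by rw [h2]

theorem isChain_iterate {δ : ℝ} (hδ : 0 < δ) (n : ℕ) (x : X) :
    IsChain T δ n x (T^[n] x) (fun i => T^[i] x) :=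
  ⟨rfl, rfl, fun i _ => by simp only [Function.iterate_succ_apply', dist_self]; exact hδ⟩

theorem ChainsTo.trans {x y z : X} (h₁ : ChainsTo T x y) (h₂ : ChainsTo T y z) :
    ChainsTo T x z := by
  intro δ hδ
  obtain ⟨m, hm, c, hc⟩ := h₁ δ hδ
  obtain ⟨n, -, d, hd⟩ := h₂ δ hδ
  obtain ⟨e, he, -⟩ := IsChain.exists_append (T := T) (δ := δ) hc hd
  exact ⟨m + n, by omega, e, he⟩

/-- On a compact set whose points are pairwise chain-related, the lengths of the connecting
`δ`-chains are bounded. -/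
theorem exists_chain_length_bound (hT : Continuous T) {K : Set X} (hK : IsCompact K)
    (h : ∀ x ∈ K, ∀ y ∈ K, ChainsTo T x y) {δ : ℝ} (hδ : 0 < δ) :
    ∃ M : ℕ, ∀ x ∈ K, ∀ y ∈ K, ∃ n ≤ M, ∃ c, IsChain T δ n x y c := by
  suffices ∃ M : ℕ, ∀ a ∈ K ×ˢ K, ∃ n ≤ M, ∃ c, IsChain T δ n a.1 a.2 c by
    obtain ⟨M, hM⟩ := this
    exact ⟨M, fun x hx y hy => hM (x, y) ⟨hx, hy⟩⟩
  refine (hK.prod hK).induction_on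
    (p := fun S => ∃ M : ℕ, ∀ a ∈ S, ∃ n ≤ M, ∃ c, IsChain T δ n a.1 a.2 c)
    ⟨0, by simp⟩ (fun s t hst ⟨M, hM⟩ => ⟨M, fun a ha => hM a (hst ha)⟩)
    (fun s t ⟨M, hM⟩ ⟨N, hN⟩ => ⟨max M N, ?_⟩) ?_
  · rintro a (ha | ha)
    · obtain ⟨n, hn, hc⟩ := hM a ha
      exact ⟨n, hn.trans (le_max_left _ _), hc⟩
    · obtain ⟨n, hn, hc⟩ := hN a ha
      exact ⟨n, hn.trans (le_max_right _ _), hc⟩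
  · -- replacing the endpoints of a chain by nearby points gives a slightly worse chain
    rintro ⟨a, b⟩ ⟨ha, hb⟩
    obtain ⟨n, hn, c, hc0, hcn, hc⟩ := h a ha b hb (δ / 3) (by positivity)
    have hU : {q : X × X | dist (T q.1) (T a) < δ / 3 ∧ dist b q.2 < δ / 3} ∈ 𝓝 (a, b) := by
      refine IsOpen.mem_nhds ?_ ⟨by simpa using by positivity, by simpa using by positivity⟩
      exact (isOpen_lt ((hT.comp continuous_fst).dist continuous_const) continuous_const).inter
        (isOpen_lt (continuous_const.dist continuous_snd) continuous_const)
    refine ⟨_, mem_nhdsWithin_of_mem_nhds hU, n, ?_⟩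
    rintro ⟨x, y⟩ ⟨hx, hy⟩
    simp only at hx hy
    refine ⟨n, le_rfl, fun i => if i = 0 then x else if i = n then y else c i,
      by simp, by simp [hn.ne'], fun i hi => ?_⟩
    have h1 : dist (T (if i = 0 then x else if i = n then y else c i)) (T (c i)) < δ / 3 := by
      rcases Nat.eq_zero_or_pos i with rfl | h0
      · simpa [hc0] using hx
      · simp [h0.ne', hi.ne, hδ]
    have h2 : dist (c (i + 1))
        (if i + 1 = 0 then x else if i + 1 = n then y else c (i + 1)) < δ / 3 := by
      by_cases hin : i + 1 = n
      · simpa [hin, hn.ne', hcn] using hy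
      · simp [hin, hδ]
    linarith [dist_triangle4 (T (if i = 0 then x else if i = n then y else c i)) (T (c i))
      (c (i + 1)) (if i + 1 = 0 then x else if i + 1 = n then y else c (i + 1)), hc i hi]

/-- Joining `m` orbit segments of length `N` to a base point `b`, before and after, by chains of
length at most `M` gives a loop at `b`, along which the sums of a function bounded by `C` differ
from those along the orbit segments by at most `2 M C` for each segment. -/
theorem exists_loop {δ : ℝ} (hδ : 0 < δ) {ι : Type*} {f : ι → X → ℝ}
    {C : ℝ} (hC : ∀ j x, |f j x| ≤ C) {M N : ℕ} {b : X} {x : ℕ → X}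
    (h₁ : ∀ i, ∃ n ≤ M, ∃ c, IsChain T δ n b (x i) c)
    (h₂ : ∀ i, ∃ n ≤ M, ∃ c, IsChain T δ n (T^[N] (x i)) b c) (m : ℕ) :
    ∃ L, m * N ≤ L ∧ ∃ c, IsChain T δ L b b c ∧ ∀ j,
      |∑ i ∈ Finset.range L, f j (c i) - ∑ i ∈ Finset.range m, birkhoffSum T (f j) N (x i)| ≤
        m * (2 * M * C) := by
  have hbound : ∀ n ≤ M, ∀ (c : ℕ → X) (j : ι), |∑ i ∈ Finset.range n, f j (c i)| ≤ M * C := by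
    intro n hn c j
    have hC0 : 0 ≤ C := (abs_nonneg _).trans (hC j b)
    refine (Finset.abs_sum_le_sum_abs _ _).trans
      ((Finset.sum_le_card_nsmul _ _ C fun i _ => hC j _).trans ?_)
    rw [Finset.card_range, nsmul_eq_mul]
    exact mul_le_mul_of_nonneg_right (by exact_mod_cast hn) hC0
  induction m with
  | zero => exact ⟨0, by simp, fun _ => b, ⟨rfl, rfl, by simp⟩, by simp⟩
  | succ m ih =>
    obtain ⟨L, hL, c, hc, hs⟩ := ih
    obtain ⟨n₁, hn₁, c₁, hc₁⟩ := h₁ m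
    obtain ⟨n₂, hn₂, c₂, hc₂⟩ := h₂ m
    obtain ⟨d, hd, hds⟩ := hc.exists_append hc₁
    obtain ⟨e, he, hes⟩ := hd.exists_append (isChain_iterate hδ N (x m))
    obtain ⟨g, hg, hgs⟩ := he.exists_append hc₂
    refine ⟨_, ?_, g, hg, fun j => ?_⟩
    · rw [add_mul, one_mul]; omega
    · rw [hgs, hes, hds, Finset.sum_range_succ]
      have h1 := abs_le.1 (hs j)
      have h2 := abs_le.1 (hbound n₁ hn₁ c₁ j)
      have h3 := abs_le.1 (hbound n₂ hn₂ c₂ j)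
      have h4 : ∑ i ∈ Finset.range N, f j (T^[i] (x m)) = birkhoffSum T (f j) N (x m) := rfl
      rw [h4, abs_le]
      push_cast
      constructor <;> linarith

theorem IsChain.isPseudoOrbit_mod {δ : ℝ} {p : ℕ} (hp : 0 < p) {b : X} {c : ℕ → X}
    (hc : IsChain T δ p b b c) : IsPseudoOrbit T δ fun n => c (n % p) :=
  TopDyn.isPseudoOrbit_mod hp (fun i hi => hc.2.2 i (by omega)) fun i hi => by
    have h := hc.2.2 i (by omega)
    rwa [hi, hc.2.1, ← hc.1] at h

end Chains

section Approximation

/-- By the strong law of large numbers, almost every sequence of independent points of law `μ` is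
equidistributed with respect to countably many integrable functions. -/
theorem exists_equidistributed {X : Type*} [MeasurableSpace X] {μ : Measure X}
    [IsProbabilityMeasure μ] {p : X → Prop} (hp : ∀ᵐ x ∂μ, p x) {ι : Type*} [Countable ι]
    {f : ι → X → ℝ} (hfm : ∀ j, Measurable (f j)) (hfi : ∀ j, Integrable (f j) μ) :
    ∃ x : ℕ → X, (∀ i, p (x i)) ∧ ∀ j, Tendsto
      (fun n : ℕ => (∑ i ∈ Finset.range n, f j (x i)) / n) atTop (𝓝 (∫ x, f j x ∂μ)) := by
  let P : Measure (ℕ → X) := Measure.infinitePi fun _ => μ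
  have hev : ∀ i, MeasurePreserving (Function.eval i) P μ := fun i =>
    measurePreserving_eval_infinitePi (fun _ : ℕ => μ) i
  have h1 : ∀ᵐ ω ∂P, ∀ i, p (ω i) := ae_all_iff.2 fun i => (hev i).quasiMeasurePreserving.ae hp
  have h2 : ∀ᵐ ω ∂P, ∀ j, Tendsto
      (fun n : ℕ => (∑ i ∈ Finset.range n, f j (ω i)) / n) atTop (𝓝 (∫ x, f j x ∂μ)) := by
    refine ae_all_iff.2 fun j => ?_
    have hi := ProbabilityTheory.iIndepFun_infinitePi (P := fun _ : ℕ => μ)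
      (X := fun _ => f j) (fun _ => hfm j)
    have h := ProbabilityTheory.strong_law_ae_real (μ := P) (fun i ω => f j (ω i))
      ((hev 0).integrable_comp_of_integrable (hfi j)) (fun a b hab => hi.indepFun hab)
      (fun i => ⟨((hfm j).comp (hev i).measurable).aemeasurable,
        ((hfm j).comp (hev 0).measurable).aemeasurable, ?_⟩)
    · have he : ∫ ω, f j (ω 0) ∂P = ∫ x, f j x ∂μ := by
        rw [← (hev 0).map_eq, integral_map (hev 0).measurable.aemeasurable
          (hfm j).aestronglyMeasurable]
      rwa [he] at h
    · have h' : ∀ i, Measure.map (fun ω : ℕ → X => f j (ω i)) P = Measure.map (f j) μ := fun i => by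
        rw [← (hev i).map_eq, Measure.map_map (hfm j) (hev i).measurable]
        rfl
      rw [h', h']
  obtain ⟨ω, hω⟩ := (h1.and h2).exists
  exact ⟨ω, hω⟩

end Approximation

/-! ### Approximation by measures supported on odometers -/

section Main

variable {X : Type*} [MetricSpace X] [CompactSpace X] [MeasurableSpace X] [BorelSpace X] {T : X → X}

/-- An invariant measure whose support consists of pairwise chain-related points is approximated by
the averages over periodic pseudo-orbits. The integral of `f` is that of its Birkhoff average of
order `n`, hence an average of means of `f` over orbit segments of length `n`, starting at points
of the support; these segments are joined to a loop by chains much shorter than `n`. -/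
theorem exists_periodic_pseudoOrbit_average_near (hT : Continuous T) {μ : Measure X}
    [IsProbabilityMeasure μ] (hμ : MeasurePreserving T μ μ)
    (hchain : ∀ x ∈ μ.support, ∀ y ∈ μ.support, ChainsTo T x y) {ι : Type*} [Finite ι]
    (f : ι → C(X, ℝ)) {δ κ : ℝ} (hδ : 0 < δ) (hκ : 0 < κ) :
    ∃ (p : ℕ) (ξ : ℕ → X), 0 < p ∧ Function.Periodic ξ p ∧ IsPseudoOrbit T δ ξ ∧
      ∀ j, |(∑ i ∈ Finset.range p, f j (ξ i)) / p - ∫ x, f j x ∂μ| ≤ κ := by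
  cases nonempty_fintype ι
  obtain ⟨b, hb⟩ := Measure.nonempty_support (IsProbabilityMeasure.ne_zero μ)
  obtain ⟨M, hM⟩ := exists_chain_length_bound hT Measure.isClosed_support.isCompact hchain hδ
  -- the test functions, centered so as to have integral `0`
  let g : ι → X → ℝ := fun j x => f j x - ∫ x, f j x ∂μ
  have hg : ∀ j, Continuous (g j) := fun j => by fun_prop
  have hg0 : ∀ j, ∫ x, g j x ∂μ = 0 := fun j => by
    simp only [g]
    rw [integral_sub (integrable_of_continuous (f j).continuous) (integrable_const _)]
    simp
  obtain ⟨C, hC⟩ : ∃ C : ℝ, ∀ j x, |g j x| ≤ C := by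
    have h : ∀ j, ∃ C : ℝ, ∀ x, |g j x| ≤ C := fun j => by
      obtain ⟨C, hC⟩ := isCompact_univ.exists_bound_of_continuousOn (hg j).continuousOn
      exact ⟨C, fun x => hC x (Set.mem_univ _)⟩
    choose C hC using h
    exact ⟨∑ j, |C j|, fun j x => (hC j x).trans ((le_abs_self _).trans
      (Finset.single_le_sum (f := fun j => |C j|) (fun _ _ => abs_nonneg _) (Finset.mem_univ j)))⟩
  -- the length of the orbit segments, large compared with that of the connecting chains
  obtain ⟨N, hN⟩ := exists_nat_gt (2 * M * C / (κ / 2))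
  have hN' : 2 * M * C ≤ (N + 1 : ℕ) * (κ / 2) := by
    rw [div_lt_iff₀ (by positivity)] at hN
    push_cast
    nlinarith
  set n := N + 1 with hn
  have hsupp : ∀ᵐ x ∂μ, x ∈ μ.support := Measure.support_mem_ae
  have hsupp' : ∀ᵐ x ∂μ, x ∈ μ.support ∧ T^[n] x ∈ μ.support :=
    hsupp.and ((hμ.iterate n).quasiMeasurePreserving.ae hsupp)
  have hB : ∀ j, Continuous (birkhoffSum T (g j) n) := fun j => by
    have : Continuous fun x => ∑ i ∈ Finset.range n, g j (T^[i] x) :=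
      continuous_finsetSum _ fun i _ => (hg j).comp (hT.iterate i)
    exact this
  have hB0 : ∀ j, ∫ x, birkhoffSum T (g j) n x ∂μ = 0 := fun j => by
    have h := integral_birkhoffAverage hμ (integrable_of_continuous (hg j)) (Nat.succ_pos N)
    simp only [birkhoffAverage, smul_eq_mul] at h
    rw [integral_const_mul, hg0, mul_eq_zero] at h
    exact h.resolve_left (by positivity)
  obtain ⟨x, hx, hlim⟩ := exists_equidistributed hsupp' (f := fun j => birkhoffSum T (g j) n)
    (fun j => (hB j).measurable) (fun j => integrable_of_continuous (hB j))
  simp only [hB0] at hlim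
  have hev : ∀ᶠ m : ℕ in atTop, ∀ j,
      |(∑ i ∈ Finset.range m, birkhoffSum T (g j) n (x i)) / m| < κ / 2 := by
    refine eventually_all.2 fun j => ?_
    have h := (hlim j).abs
    rw [abs_zero] at h
    exact h.eventually_lt_const (by positivity)
  obtain ⟨m, hm, hm0⟩ := (hev.and (eventually_gt_atTop 0)).exists
  have hm0' : (0 : ℝ) < m := by exact_mod_cast hm0
  obtain ⟨L, hL, c, hc, hs⟩ := exists_loop hδ hC (fun i => hM b hb (x i) (hx i).1)
    (fun i => hM _ (hx i).2 b hb) m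
  have hL0 : 0 < L := lt_of_lt_of_le (by positivity) hL
  have hL0' : (0 : ℝ) < L := by exact_mod_cast hL0
  refine ⟨L, fun i => c (i % L), hL0, fun i => by simp, hc.isPseudoOrbit_mod hL0, fun j => ?_⟩
  have h1 : (∑ i ∈ Finset.range L, f j (c (i % L))) / L - ∫ x, f j x ∂μ =
      (∑ i ∈ Finset.range L, g j (c i)) / L := by
    have : ∑ i ∈ Finset.range L, f j (c (i % L)) = ∑ i ∈ Finset.range L, f j (c i) :=
      Finset.sum_congr rfl fun i hi => by rw [Nat.mod_eq_of_lt (Finset.mem_range.1 hi)]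
    simp only [this, g, Finset.sum_sub_distrib, Finset.sum_const, Finset.card_range, nsmul_eq_mul]
    field_simp
  rw [h1, abs_div, abs_of_pos hL0', div_le_iff₀ hL0']
  have h2 := hm j
  rw [abs_div, abs_of_pos hm0', div_lt_iff₀ hm0'] at h2
  have h3 := (abs_sub_abs_le_abs_sub _ _).trans (hs j)
  have h4 : (m : ℝ) * (2 * M * C) ≤ m * (n * (κ / 2)) := mul_le_mul_of_nonneg_left hN' hm0'.le
  have h5 : (m : ℝ) * n ≤ L := by exact_mod_cast hL
  have h6 : (1 : ℝ) ≤ n := by rw [hn]; push_cast; linarith [Nat.cast_nonneg (α := ℝ) N]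
  have h7 : κ / 2 * m ≤ κ / 2 * (m * n) :=
    mul_le_mul_of_nonneg_left (le_mul_of_one_le_right hm0'.le h6) (by positivity)
  have h8 : κ * (m * n) ≤ κ * L := mul_le_mul_of_nonneg_left h5 hκ.le
  linarith

theorem exists_odometer_integral_near (hT : Continuous T) (hs : HasShadowing T)
    (μ : invariantMeasures T)
    (hchain : ∀ x ∈ ((μ : ProbabilityMeasure X) : Measure X).support,
      ∀ y ∈ ((μ : ProbabilityMeasure X) : Measure X).support, ChainsTo T x y)
    {ι : Type*} [Finite ι] (f : ι → C(X, ℝ)) {κ : ℝ} (hκ : 0 < κ) :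
    ∃ ν : invariantMeasures T,
      (∃ y, IsOdometerPoint T y ∧
        ∀ᵐ x ∂((ν : ProbabilityMeasure X) : Measure X), x ∈ orbitClosure T y) ∧
      ∀ j, |∫ x, f j x ∂((ν : ProbabilityMeasure X) : Measure X) -
        ∫ x, f j x ∂((μ : ProbabilityMeasure X) : Measure X)| ≤ κ := by
  have hunif : ∀ᶠ ε in 𝓝[>] (0 : ℝ), ∀ j, ∀ a b : X, dist a b ≤ ε →
      |f j a - f j b| ≤ κ / 2 := by
    refine eventually_all.2 fun j => ?_
    obtain ⟨d, hd, h⟩ := Metric.uniformContinuous_iff.1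
      (CompactSpace.uniformContinuous_of_continuous (f j).continuous) (κ / 2) (by positivity)
    filter_upwards [Ioo_mem_nhdsGT hd] with ε hε a b hab
    exact (h (hab.trans_lt hε.2)).le
  obtain ⟨ε, hε, hε0⟩ := (hunif.and self_mem_nhdsWithin).exists
  obtain ⟨δ, hδ, htrace⟩ := exists_isOdometerPoint hT hs hε0
  obtain ⟨p, ξ, hp, hξ, hξδ, havg⟩ :=
    exists_periodic_pseudoOrbit_average_near hT μ.2 hchain f hδ (half_pos hκ)
  obtain ⟨y, hy, hyξ⟩ := htrace p ξ hp hξ hξδ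
  obtain ⟨ν, hν⟩ := exists_invariant_orbitClosure hT y
  refine ⟨ν, ⟨y, hy, hν⟩, fun j => ?_⟩
  have h := abs_integral_sub_le hT ν.2 (f j).continuous hν hp fun x hx =>
    abs_birkhoffAverage_sub_le hT (f j).continuous hp hξ (fun n => hε j _ _ (hyξ n)) hx
  exact (abs_sub_le _ _ _).trans ((add_le_add h (havg j)).trans_eq (add_halves κ))

/-- Convergence is tested on a dense sequence in `C(X, ℝ)`, of which the `k`-th measure handles the
first `k + 1` terms. -/
theorem exists_seq_odometer_tendsto (hT : Continuous T) (hs : HasShadowing T)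
    (μ : invariantMeasures T)
    (hchain : ∀ x ∈ ((μ : ProbabilityMeasure X) : Measure X).support,
      ∀ y ∈ ((μ : ProbabilityMeasure X) : Measure X).support, ChainsTo T x y) :
    ∃ ν : ℕ → invariantMeasures T,
      (∀ k, ∃ y, IsOdometerPoint T y ∧
        ∀ᵐ x ∂((ν k : ProbabilityMeasure X) : Measure X), x ∈ orbitClosure T y) ∧
      Tendsto ν atTop (𝓝 μ) := by
  let D : ℕ → C(X, ℝ) := TopologicalSpace.denseSeq C(X, ℝ)
  choose ν hν hνf using fun k : ℕ => exists_odometer_integral_near hT hs μ hchain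
    (fun j : Fin (k + 1) => D j) (κ := 1 / ((k : ℝ) + 1)) (by positivity)
  refine ⟨ν, hν, ?_⟩
  rw [tendsto_subtype_rng, ProbabilityMeasure.tendsto_iff_forall_integral_tendsto]
  intro f
  rw [Metric.tendsto_atTop]
  intro ε hε
  obtain ⟨_, hg, ⟨j, rfl⟩⟩ := Metric.dense_iff.1 (TopologicalSpace.denseRange_denseSeq C(X, ℝ))
    f.toContinuousMap (ε / 3) (by positivity)
  have hclose : ∀ ρ : ProbabilityMeasure X,
      |∫ x, f x ∂(ρ : Measure X) - ∫ x, D j x ∂(ρ : Measure X)| ≤ ε / 3 := by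
    intro ρ
    rw [← integral_sub (f.integrable _) (integrable_of_continuous (D j).continuous),
      ← Real.norm_eq_abs]
    refine (norm_integral_le_of_norm_le_const (C := ε / 3) (ae_of_all _ fun x => ?_)).trans_eq
      (by simp)
    exact (ContinuousMap.dist_apply_le_dist (f := f.toContinuousMap) (g := D j) x).trans
      (Metric.mem_ball'.1 hg).le
  obtain ⟨K, hK⟩ := exists_nat_one_div_lt (show 0 < ε / 3 by positivity)
  refine ⟨max j K, fun k hk => ?_⟩
  have h1 := hνf k ⟨j, Nat.lt_succ_of_le ((le_max_left _ _).trans hk)⟩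
  have h2 : 1 / ((k : ℝ) + 1) ≤ 1 / ((K : ℝ) + 1) :=
    Nat.one_div_le_one_div ((le_max_right _ _).trans hk)
  have h3 := abs_le.1 (hclose (ν k))
  have h4 := abs_le.1 (hclose μ)
  have h5 := abs_le.1 (h1.trans h2)
  rw [Real.dist_eq, abs_lt]
  constructor <;> linarith [h5.1, h5.2]

omit [CompactSpace X] [MeasurableSpace X] [BorelSpace X] in
theorem IsTransitive.chainsTo (hT : IsTransitive T) (x y : X) : ChainsTo T x y := by
  intro δ hδ
  obtain ⟨n, hn, _, ⟨u, hu, rfl⟩, hy⟩ := hT (Metric.ball (T x) δ) (Metric.ball y δ)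
    Metric.isOpen_ball Metric.isOpen_ball ⟨_, Metric.mem_ball_self hδ⟩ ⟨_, Metric.mem_ball_self hδ⟩
  -- the chain `x, u, T u, …, T^[n - 1] u, y`
  refine ⟨n + 1, n.succ_pos, fun i => if i = 0 then x else if i = n + 1 then y else T^[i - 1] u,
    by simp, by simp, fun i hi => ?_⟩
  rcases Nat.eq_zero_or_pos i with rfl | h0
  · simpa [hn.ne', dist_comm] using hu
  · obtain ⟨i, rfl⟩ := Nat.exists_eq_succ_of_ne_zero h0.ne'
    have hTi : T (T^[i] u) = T^[i + 1] u := (Function.iterate_succ_apply' T i u).symm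
    by_cases hin : i + 1 = n
    · subst hin
      simpa [hTi] using hy
    · have : i ≠ n := by omega
      simp [this, hin, hTi, hδ]

end Main

end TopDyn

theorem theoremA {X : Type*} [MetricSpace X] [CompactSpace X] [MeasurableSpace X] [BorelSpace X]
    (T : X → X) (hT : Continuous T) (hshadow : TopDyn.HasShadowing T) :
    (∀ μ : TopDyn.invariantMeasures T,
      (∃ x ∈ TopDyn.chainRecurrentSet T,
        ((μ : ProbabilityMeasure X) : Measure X).support ⊆ TopDyn.chainClass T x) →
      ∃ ν : ℕ → TopDyn.invariantMeasures T,
        (∀ k, ν k ∈ TopDyn.odometerMeasures T) ∧ Tendsto ν atTop (𝓝 μ)) ∧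
    (TopDyn.IsTransitive T →
      Dense (TopDyn.odometerMeasures T) ∧
      TopDyn.ergodicMeasures T ∈ residual (TopDyn.invariantMeasures T)) := by
  refine ⟨fun μ ⟨x, _, hμ⟩ => ?_, fun htrans => ?_⟩
  · obtain ⟨ν, hν, hlim⟩ := TopDyn.exists_seq_odometer_tendsto hT hshadow μ
      fun a ha b hb => (hμ ha).2.trans (hμ hb).1
    refine ⟨ν, fun k => ?_, hlim⟩
    obtain ⟨y, hy, hZ⟩ := hν k
    exact hy.mem_odometerMeasures hT hZ
  · have hdense : Dense {ν : TopDyn.invariantMeasures T | ∃ y, TopDyn.IsOdometerPoint T y ∧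
        ∀ᵐ x ∂((ν : ProbabilityMeasure X) : Measure X), x ∈ TopDyn.orbitClosure T y} := fun μ => by
      obtain ⟨ν, hν, hlim⟩ := TopDyn.exists_seq_odometer_tendsto hT hshadow μ
        fun a _ b _ => htrans.chainsTo a b
      exact mem_closure_of_tendsto hlim (Eventually.of_forall hν)
    refine ⟨hdense.mono ?_, TopDyn.ergodicMeasures_mem_residual hT hdense⟩
    rintro ν ⟨y, hy, hZ⟩
    exact hy.mem_odometerMeasures hT hZ
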